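/- Let $\alpha=[0;a_1,a_2,a_3,\ldots]\in(0,1)$ be irrational, with continuants $q_{-1}=0$, $q_0=1$, $q_{n+1}=a_{n+1}q_n+q_{n-1}$, and characteristic Sturmian word $c_\alpha=\lim s_n$, where $s_0=0$, $s_1=0^{a_1-1}1$, $s_{n+1}=s_n^{a_{n+1}}s_{n-1}$ for $n\ge 1$. Let $T$ denote the shift on infinite words. An $\alpha$-number is a sequence $\rho=(\rho_n)_{n\ge 0}$ of integers with $0\le\rho_n<q_n$ and $\rho_{n+1}\equiv\rho_n \pmod{q_n}$ for all $n$; equivalently a formal Ostrowski sum $\rho=\sum_{i\ge0}b_{i+1}q_i$, where $\rho_{i+1}=b_{i+1}q_i+\rho_i$. Put $T^\rho(c_\alpha)=\lim_n T^{\rho_n}(c_\alpha)$; the $\alpha$-number $\rho+k$ is the one with $T^{\rho+k}(c_\alpha)=T^k(T^\rho(c_\alpha))$. Two $\alpha$-numbers $\rho,\gamma$ are equivalent if $\rho+k=\gamma+l$ for some integers $k,l\ge0$. The zero class is the class of $0=(0)_{n\geq 0}$. For $n\le m$ let $\Psi_n:[0,q_m[\to[0,q_n[$ be the composite of the successive reductions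 modulo $q_{m-1},\ldots,q_{n+1},q_n$. If infinitely many $b_i$ are non-zero, let $\Lambda(n)=\min\{m\ge n: b_{m+1}\ne0\}$; the complement of $\rho$ is the $\alpha$-number $\overline\rho$ such that, for all large $n$, $$\overline\rho_n=\Psi_n\bigl(q_{\Lambda(n)+1}-2-\rho_{\Lambda(n)+1}\bigr),\qquad q_{\Lambda(n)+1}-2-\rho_{\Lambda(n)+1}\ge 0 .$$ Let $y=y_1y_2y_3\cdots\in\{0,1\}^{\mathbb N}$ with $y_i\equiv a_i\pmod 2$, and let $\mathcal B=\{00,01\}\cup\{10^k10,\,10^k11: k\ge0\}$. A $\mathcal B$-factorisation of an indexed suffix of $y$ is a pair $(n,(u_j)_{j\ge1})$ with $n\ge0$, $u_j\in\mathcal B$ and $T^n(y)=u_1u_2u_3\cdots$. Two such factorisations are equivalent if one of them, say $(m,(v_j))$, is obtained from the other, $(n,(u_j))$, by removing its first $l$ factors for some $l\ge0$: $v_j=u_{j+l}$ for all $j\geq 1$ and $m=n+|u_1\cdots u_l|$. To $(n,(u_j))$ attach the indices $c_j=n-1+|u_1\cdots u_{j-1}|$, $j\ge1$. **Theorem.**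 Suppose that the partial quotients $a_i$ are not eventually all even. Then there are exactly three non-zero equivalence classes of $\alpha$-numbers equivalent to their complement. They are obtained as follows. 1. For every $\mathcal B$-factorisation of an indexed suffix of $y$, the integers $q_{c_{j+1}}-q_{c_j}$ are even and there is a unique $\alpha$-number $$\rho=\sum_{j\ge1}\frac{q_{c_{j+1}}-q_{c_j}}2,\quad\text{i.e.}\quad \rho_{c_j}=\sum_{1\le l<j}\frac{q_{c_{l+1}}-q_{c_l}}2\ \text{ for all } j\ge1 \text{ with } c_j\geq 0 .$$ It has non-zero class and is equivalent to its complement. 2. Two such $\alpha$-numbers are equivalent if and only if the corresponding $\mathcal B$-factorisations are equivalent. 3. There are exactly three equivalence classes of $\mathcal B$-factorisations of indexed suffixes of $y$, and every $\alpha$-number of non-zero class that is equivalent to its complement is equivalent to one of the three $\alpha$-numbers attached to them. -/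

import Mathlib

open Filter Topology

/-! Throughout, the sequence of partial quotients of a slope `[0; a₁, a₂, …]` is given as
`a : ℕ → ℕ+` with the index shifted by one: `a i` is the partial quotient `a_{i+1}`.
Infinite words are functions `ℕ → Fin 2`, their first letter having index `0`. -/

namespace Sturm

/-- The real number `α` is a slope, with sequence of partial quotients `a`:
it is irrational, `0 < α < 1`, and `α = [0; a 0, a 1, a 2, …]`. -/
structure IsSlope (α : ℝ) (a : ℕ → ℕ+) : Prop where
  irrational : Irrational α
  pos : 0 < α
  lt_one : α < 1
  partDens : ∀ i, (GenContFract.of α).partDens.get? i = some (((a i : ℕ) : ℝ))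

/-- Continuants with the index shifted by one: `contShift a n` is `q_{n-1}`, so that
`q_{-1} = 0`, `q_0 = 1` and `q_{n+1} = a_{n+1} q_n + q_{n-1}`. -/
def contShift (a : ℕ → ℕ+) : ℕ → ℕ
  | 0 => 0
  | 1 => 1
  | n + 2 => (a n : ℕ) * contShift a (n + 1) + contShift a n

/-- The continuant `q_n`, for `n ≥ 0`. -/
def cont (a : ℕ → ℕ+) (n : ℕ) : ℕ := contShift a (n + 1)

theorem contShift_pos (a : ℕ → ℕ+) : ∀ n, 0 < contShift a (n + 1)
  | 0 => Nat.one_pos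
  | n + 1 => by
    have h := contShift_pos a n
    have h2 : 0 < (a n : ℕ) * contShift a (n + 1) := Nat.mul_pos (a n).pos h
    simp only [contShift]
    omega

theorem cont_pos (a : ℕ → ℕ+) (n : ℕ) : 0 < cont a n := contShift_pos a n

/-! ### The characteristic word -/

/-- The standard words: `s_0 = 0`, `s_1 = 0^{a_1 - 1} 1` and `s_{n+1} = s_n^{a_{n+1}} s_{n-1}`. -/
def stdWord (a : ℕ → ℕ+) : ℕ → List (Fin 2)
  | 0 => [0]
  | 1 => List.replicate ((a 0 : ℕ) - 1) 0 ++ [1]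
  | n + 2 => (List.replicate (a (n + 1) : ℕ) (stdWord a (n + 1))).flatten ++ stdWord a n

theorem length_stdWord (a : ℕ → ℕ+) : ∀ n, (stdWord a n).length = cont a n
  | 0 => rfl
  | 1 => by
    have := (a 0).pos
    simp [stdWord, cont, contShift]
    omega
  | n + 2 => by
    have h1 := length_stdWord a n
    have h2 := length_stdWord a (n + 1)
    simp only [cont] at h1 h2
    simp [stdWord, cont, contShift, h1, h2]

theorem le_cont (a : ℕ → ℕ+) : ∀ n, n ≤ cont a n
  | 0 => Nat.zero_le _
  | 1 => cont_pos a 1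
  | n + 2 => by
    have h1 := le_cont a (n + 1)
    have h2 := cont_pos a n
    have h3 : cont a (n + 1) ≤ (a (n + 1) : ℕ) * cont a (n + 1) :=
      Nat.le_mul_of_pos_left _ (a (n + 1)).pos
    have h4 : cont a (n + 2) = (a (n + 1) : ℕ) * cont a (n + 1) + cont a n := rfl
    omega

/-- The characteristic word `c_α = lim s_n`. The word `s_{k+2}` has more than `k` letters and is a
prefix of all the following `s_n`, so its letter of index `k` is the one of the limit;
see `stdWord_getElem?`. -/
def charWord (a : ℕ → ℕ+) : ℕ → Fin 2 := fun k => (stdWord a (k + 2)).getD k 0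

theorem stdWord_prefix_succ (a : ℕ → ℕ+) (n : ℕ) : stdWord a (n + 1) <+: stdWord a (n + 2) := by
  obtain ⟨m, hm⟩ : ∃ m, (a (n + 1) : ℕ) = m + 1 := ⟨_, (Nat.succ_pred_eq_of_pos (a (n + 1)).pos).symm⟩
  simp only [stdWord, hm, List.replicate_succ, List.flatten_cons, List.append_assoc]
  exact List.prefix_append _ _

theorem stdWord_prefix (a : ℕ → ℕ+) (n : ℕ) : ∀ d, stdWord a (n + 1) <+: stdWord a (n + 1 + d)
  | 0 => List.prefix_refl _
  | d + 1 => (stdWord_prefix a n d).trans (by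
      have := stdWord_prefix_succ a (n + d)
      rwa [show n + d + 1 = n + 1 + d by omega, show n + d + 2 = n + 1 + (d + 1) by omega] at this)

/-- Every `s_n` with `n ≥ 1` is a prefix of the characteristic word. -/
theorem stdWord_getElem? (a : ℕ → ℕ+) (n k : ℕ) (hk : k < (stdWord a (n + 1)).length) :
    (stdWord a (n + 1))[k]? = some (charWord a k) := by
  have hk2 : k < (stdWord a (k + 1 + 1)).length := by
    rw [length_stdWord]
    have := le_cont a (k + 1 + 1)
    omega
  have key : (stdWord a (n + 1))[k]? = (stdWord a (k + 1 + 1))[k]? := by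
    rcases le_total n (k + 1) with h | h
    · obtain ⟨t, ht⟩ := stdWord_prefix a n (k + 1 - n)
      rw [show n + 1 + (k + 1 - n) = k + 1 + 1 by omega] at ht
      rw [← ht, List.getElem?_append_left hk]
    · obtain ⟨t, ht⟩ := stdWord_prefix a (k + 1) (n - (k + 1))
      rw [show k + 1 + 1 + (n - (k + 1)) = n + 1 by omega] at ht
      rw [← ht, List.getElem?_append_left hk2]
  rw [key, charWord, List.getD_eq_getElem?_getD, List.getElem?_eq_getElem hk2]
  rfl

/-- The `m`-th iterate `T^m` of the shift on infinite words. -/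
def shift (m : ℕ) (x : ℕ → Fin 2) : ℕ → Fin 2 := fun k => x (m + k)

/-! ### `α`-numbers -/

/-- An `α`-number: an element `(ρ_n)` of the projective limit of the integer intervals `[0, q_n[`
for the reductions modulo `q_n`. The component `ρ_0` in `[0, q_0[ = {0}` is zero. -/
@[ext]
structure AlphaNumber (a : ℕ → ℕ+) where
  comp : ℕ → ℕ
  lt : ∀ n, comp n < cont a n
  compat : ∀ n, comp (n + 1) % cont a n = comp n

namespace AlphaNumber

variable {a : ℕ → ℕ+}

instance : Zero (AlphaNumber a) where
  zero := ⟨fun _ => 0, cont_pos a, fun _ => Nat.zero_mod _⟩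

/-- The coefficient `b_{i+1}` of `q_i` in the Ostrowski expansion `ρ = ∑ b_{i+1} q_i`;
indeed `ρ_{i+1} = b_{i+1} q_i + ρ_i` with `ρ_i < q_i`. -/
def digit (ρ : AlphaNumber a) (i : ℕ) : ℕ := ρ.comp (i + 1) / cont a i

/-- `x = T^ρ(c_α)`, that is, `x = lim T^{ρ_n}(c_α)` in the product topology: the word `x` has
formal intercept `ρ`. -/
def IsIntercept (ρ : AlphaNumber a) (x : ℕ → Fin 2) : Prop :=
  Tendsto (fun n => shift (ρ.comp n) (charWord a)) atTop (𝓝 x)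

/-- `σ = ρ + k`: the `α`-number `σ` is the formal intercept of the word `T^k(T^ρ(c_α))`. -/
def IsAdd (ρ : AlphaNumber a) (k : ℕ) (σ : AlphaNumber a) : Prop :=
  ∃ x, ρ.IsIntercept x ∧ σ.IsIntercept (shift k x)

/-- Equivalence of `α`-numbers: `ρ + k = γ + l` for some integers `k, l ≥ 0`. -/
def Equivalent (ρ γ : AlphaNumber a) : Prop :=
  ∃ k l σ, ρ.IsAdd k σ ∧ γ.IsAdd l σ

end AlphaNumber

/-- The projection `Ψ_n^{n+d} : [0, q_{n+d}[ → [0, q_n[`, the composite of the successive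
reductions modulo `q_{n+d-1}`, …, `q_{n+1}`, `q_n`. -/
def proj (a : ℕ → ℕ+) (n : ℕ) : ℕ → ℕ → ℕ
  | 0, k => k
  | d + 1, k => proj a n d (k % cont a (n + d))

namespace AlphaNumber

variable {a : ℕ → ℕ+}

/-- `σ` is the complement of `ρ`, that is, for all large `n`,
`σ_n = Ψ_n(q_{Λ(n)+1} - 2 - ρ_{Λ(n)+1})`, where `Λ(n)` is the least element `m ≥ n` of the support
of `ρ`. Below, `k` is the integer `q_{Λ(n)+1} - 2 - ρ_{Λ(n)+1}`, required to be non-negative. -/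
def IsComplement (ρ σ : AlphaNumber a) : Prop :=
  ∀ᶠ n in atTop, ∃ m k, IsLeast {i | n ≤ i ∧ ρ.digit i ≠ 0} m ∧
    k + 2 + ρ.comp (m + 1) = cont a (m + 1) ∧ σ.comp n = proj a n (m + 1 - n) k

/-- `ρ` is equivalent to its complement. -/
def EquivalentToComplement (ρ : AlphaNumber a) : Prop :=
  ∃ σ, ρ.IsComplement σ ∧ ρ.Equivalent σ

end AlphaNumber

/-! ### `B`-factorisations -/

/-- The set of words `B = {00, 01} ∪ {1 0^k 1 0, 1 0^k 1 1 : k ≥ 0}`. -/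
def wordsB : Set (List (Fin 2)) :=
  {[0, 0], [0, 1]} ∪ {u | ∃ k, u = 1 :: (List.replicate k 0 ++ [1, 0]) ∨
    u = 1 :: (List.replicate k 0 ++ [1, 1])}

/-- The infinite word whose letters are the parities of the partial quotients. -/
def parityWord (a : ℕ → ℕ+) : ℕ → Fin 2 := fun i => Fin.ofNat 2 (a i : ℕ)

/-- The position where the factor of index `j` begins in `T^n(y) = u_0 u_1 u_2 ⋯`:
`n + |u_0 ⋯ u_{j-1}|`. -/
def cutAt (n : ℕ) (u : ℕ → List (Fin 2)) (j : ℕ) : ℕ :=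
  n + ∑ l ∈ Finset.range j, (u l).length

/-- A `B`-factorisation `(n, (u_j))` of an indexed suffix of `y`: all `u_j` belong to `B` and
`T^n(y) = u_0 u_1 u_2 ⋯`. -/
structure BFactorisation (y : ℕ → Fin 2) where
  start : ℕ
  factor : ℕ → List (Fin 2)
  mem : ∀ j, factor j ∈ wordsB
  eq : ∀ j, factor j =
    (List.range (factor j).length).map fun i => y (cutAt start factor j + i)

namespace BFactorisation

variable {y : ℕ → Fin 2}

/-- The positions in `y` where the factors begin. -/
def cut (F : BFactorisation y) (j : ℕ) : ℕ := cutAt F.start F.factor j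

/-- `G` is obtained from `F` by removing the first `l` factors, for some `l ≥ 0`. -/
def IsTail (F G : BFactorisation y) : Prop :=
  ∃ l, G.start = F.cut l ∧ ∀ j, G.factor j = F.factor (j + l)

/-- Equivalence of factorisations: one of them is a tail of the other. -/
def Equivalent (F G : BFactorisation y) : Prop := F.IsTail G ∨ G.IsTail F

/-- With `c_j = F.cut j - 1`, the differences `q_{c_{j+1}} - q_{c_j}` are even, and `ρ` is the
`α`-number `∑_j (q_{c_{j+1}} - q_{c_j}) / 2`, that is, `ρ_{c_j} = ∑_{l < j} (q_{c_{l+1}} - q_{c_l}) / 2`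
for all `j` (such that `c_j ≥ 0`). Below, `h l` is the integer `(q_{c_{l+1}} - q_{c_l}) / 2`, and
`contShift a (F.cut l)` is `q_{c_l}`, where `q_{-1} = 0`. -/
def Represents {a : ℕ → ℕ+} (F : BFactorisation (parityWord a)) (ρ : AlphaNumber a) : Prop :=
  ∃ h : ℕ → ℕ, (∀ l, contShift a (F.cut l) + 2 * h l = contShift a (F.cut (l + 1))) ∧
    ∀ j, 1 ≤ F.cut j → ρ.comp (F.cut j - 1) = ∑ l ∈ Finset.range j, h l

end BFactorisation

end Sturm

namespace Sturm

variable {a : ℕ → ℕ+}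

/-! ### Continuants -/

/-! Equivalence can be read on components. The prefixes of `c_α` have almost the period `q_n`
(`charWord_add_cont`), and their factors of length `q_n - 1` starting before `q_n` are distinct
(`charWord_factors_ne`), so a word determines its formal intercept (`word_injective`). Hence,
outside the zero class, `ρ` and `γ` are equivalent exactly when `ρ_n - γ_n` is eventually constant.

Suppose that the complement of `ρ` has components `ρ_n + d` for large `n`, and put `e = d + 2`.
Where the digit of `q_n` is non-zero, the definition of the complement says `2ρ_n + e ≡ q_{n-1}`
modulo `q_n`. Since `0 < 2ρ_n + e < 2q_n`, the value is `q_{n-1}` or `q_n + q_{n-1}`. Going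
backwards through zero digits adds only the value `q_n`. So `2ρ_n + e` is always one of three linear
forms, the three states.

From `n` to `n + 1` this value grows by an even multiple of `q_n`, which forces the next state from
the present one and the parity of `a_{n+1}` (`val_step`, `eq_of_val_sub_eq`). Each parity permutes
the states, so there are exactly three state sequences, different at every index. Different
sequences give inequivalent numbers because the gaps between the forms tend to infinity. Conversely,
a number following a state sequence is equivalent to its complement
(`HasState.equivalentToComplement`, `exists_hasState`).

The words of `B` are the first-return words to the state of the form `q_{n-1}`. A factorisation
therefore records the visits of one sequence to that state, and its `α`-number is half the
telescoping sum of the form between visits. Infinitely many odd partial quotients ensure that every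
sequence keeps returning there. -/

theorem cont_add_two (n : ℕ) : cont a (n + 2) = (a (n + 1) : ℕ) * cont a (n + 1) + cont a n := rfl

theorem cont_add_le (n : ℕ) : cont a (n + 1) + cont a n ≤ cont a (n + 2) := by
  have : cont a (n + 1) ≤ (a (n + 1) : ℕ) * cont a (n + 1) :=
    Nat.le_mul_of_pos_left _ (a (n + 1)).pos
  rw [cont_add_two]; omega

theorem cont_le_succ : ∀ n, cont a n ≤ cont a (n + 1)
  | 0 => cont_pos a 1
  | n + 1 => (Nat.le_add_right _ _).trans (cont_add_le n)

theorem cont_mono : Monotone (cont a) := monotone_nat_of_le_succ cont_le_succ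

theorem tendsto_cont : Tendsto (cont a) atTop atTop := tendsto_atTop_mono (le_cont a) tendsto_id

/-! ### Periods of the prefixes of the characteristic word -/

/-- Each recursion step puts the same power of `s_{n+1}` in front of both products of the previous
level and interchanges them, so they keep differing only in their last two letters. This is the
source of the `2` in the period bounds. -/
theorem stdWord_append_comm (a : ℕ → ℕ+) : ∀ n, ∃ w x y,
    stdWord a (n + 1) ++ stdWord a n = w ++ [x, y] ∧
      stdWord a n ++ stdWord a (n + 1) = w ++ [y, x]
  | 0 => ⟨List.replicate ((a 0 : ℕ) - 1) 0, 1, 0, by simp [stdWord], by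
      rw [stdWord, stdWord, ← List.append_assoc, ← List.replicate_one, ← List.replicate_add,
        add_comm, List.replicate_add]
      simp⟩
  | n + 1 => by
    obtain ⟨w, x, y, h1, h2⟩ := stdWord_append_comm a n
    refine ⟨(List.replicate (a (n + 1) : ℕ) (stdWord a (n + 1))).flatten ++ w, y, x, ?_, ?_⟩
    · rw [stdWord, List.append_assoc, h2, List.append_assoc]
    · rw [stdWord, ← List.append_assoc, ← List.flatten_cons, ← List.replicate_succ,
        List.replicate_succ', List.flatten_append, List.flatten_singleton, List.append_assoc, h1,
        List.append_assoc]

theorem stdWord_succ_getElem? {n k : ℕ} (hk : k < cont a (n + 1)) :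
    (stdWord a (n + 1))[k]? = some (charWord a k) :=
  stdWord_getElem? a n k (by rwa [length_stdWord])

theorem charWord_cont_add {n j : ℕ} (hj : j < cont a (n + 1)) :
    charWord a (cont a (n + 2) + j) = charWord a j := by
  have hlt : cont a (n + 2) + j < cont a (n + 3) := by
    have : cont a (n + 2) + cont a (n + 1) ≤ cont a (n + 3) := cont_add_le (n + 1)
    omega
  have hj' : j < cont a (n + 2) := hj.trans_le (cont_le_succ _)
  have h := stdWord_succ_getElem? hlt
  obtain ⟨m, hm⟩ : ∃ m, (a (n + 2) : ℕ) = m + 1 :=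
    ⟨_, (Nat.succ_pred_eq_of_pos (a (n + 2)).pos).symm⟩
  rw [stdWord, hm, List.replicate_succ, List.flatten_cons, List.append_assoc,
    List.getElem?_append_right (by rw [length_stdWord]; exact Nat.le_add_right _ _),
    length_stdWord, Nat.add_sub_cancel_left] at h
  rcases m with _ | m
  · rw [List.replicate_zero, List.flatten_nil, List.nil_append, stdWord_succ_getElem? hj] at h
    exact (Option.some.inj h).symm
  · rw [List.replicate_succ, List.flatten_cons, List.append_assoc,
      List.getElem?_append_left (by rwa [length_stdWord]), stdWord_succ_getElem? hj'] at h
    exact (Option.some.inj h).symm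

/-- The prefix of length `q_{n+1} + q_n - 2` of the characteristic word has period `q_n`. -/
theorem charWord_add_cont {n k : ℕ} (hk : k + 2 < cont a (n + 1)) :
    charWord a (k + cont a n) = charWord a k := by
  obtain ⟨w, x, y, h1, h2⟩ := stdWord_append_comm a n
  have hw : w.length + 2 = cont a n + cont a (n + 1) := by
    have := congrArg List.length h2
    simp only [List.length_append, length_stdWord, List.length_cons, List.length_nil] at this
    omega
  -- The position `k + q_n` lies before the last two letters, where both products agree. One product
  -- shows the letter `k` there, the other the letter `k + q_n`.
  have h3 : (stdWord a n ++ stdWord a (n + 1))[k + cont a n]? = some (charWord a k) := by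
    rw [List.getElem?_append_right (by rw [length_stdWord]; omega), length_stdWord,
      Nat.add_sub_cancel, stdWord_succ_getElem? (by omega)]
  have h4 : (stdWord a (n + 1) ++ stdWord a n)[k + cont a n]? = some (charWord a k) := by
    rw [← h3, h1, h2, List.getElem?_append_left (by omega), List.getElem?_append_left (by omega)]
  rcases lt_or_ge (k + cont a n) (cont a (n + 1)) with h | h
  · rw [List.getElem?_append_left (by rwa [length_stdWord]), stdWord_succ_getElem? h] at h4
    exact Option.some.inj h4
  · rw [List.getElem?_append_right (by rwa [length_stdWord]), length_stdWord] at h4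
    rcases n with _ | n
    · have : cont a 0 = 1 := rfl
      omega
    · obtain ⟨j, hj⟩ := Nat.exists_eq_add_of_le h
      have hj1 : j < cont a (n + 1) := by omega
      rw [hj, Nat.add_sub_cancel_left, stdWord_succ_getElem? hj1] at h4
      rw [hj, ← Option.some.inj h4]
      exact charWord_cont_add hj1

theorem charWord_add_mul_cont {n k : ℕ} : ∀ {b : ℕ},
    k + b * cont a n + 2 < cont a (n + 1) + cont a n → charWord a (k + b * cont a n) = charWord a k
  | 0, _ => by simp
  | b + 1, h => by
    rw [Nat.succ_mul] at h
    rw [Nat.succ_mul, ← add_assoc, charWord_add_cont (by omega), charWord_add_mul_cont (by omega)]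

/-! ### Distinct conjugates of the standard words -/

theorem sum_map_stdWord_add_two (n : ℕ) :
    ((stdWord a (n + 2)).map Fin.val).sum =
      (a (n + 1) : ℕ) * ((stdWord a (n + 1)).map Fin.val).sum +
        ((stdWord a n).map Fin.val).sum := by
  simp [stdWord, List.map_flatten, List.sum_flatten]

/-- The numbers of ones obey the same recursion as the `q_n`, so the determinant only changes sign.
Squaring removes the sign and still yields Bézout coefficients in `coprime_cont_sum`. -/
theorem stdWord_det_sq (a : ℕ → ℕ+) : ∀ n,
    ((((stdWord a (n + 1)).map Fin.val).sum : ℤ) * cont a n -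
      ((stdWord a n).map Fin.val).sum * cont a (n + 1)) ^ 2 = 1
  | 0 => by simp [stdWord, cont, contShift]
  | n + 1 => by
    rw [← stdWord_det_sq a n, sum_map_stdWord_add_two, cont_add_two]
    push_cast
    ring

theorem coprime_cont_sum (a : ℕ → ℕ+) (n : ℕ) :
    Nat.Coprime (cont a n) ((stdWord a n).map Fin.val).sum := by
  rw [← Nat.isCoprime_iff_coprime]
  have h := stdWord_det_sq a n
  set p := (((stdWord a n).map Fin.val).sum : ℤ)
  set p' := (((stdWord a (n + 1)).map Fin.val).sum : ℤ)
  exact ⟨p' * (p' * cont a n - p * cont a (n + 1)),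
    -cont a (n + 1) * (p' * cont a n - p * cont a (n + 1)), by rw [← h]; ring⟩

theorem stdWord_succ_eq (a : ℕ → ℕ+) (n : ℕ) :
    stdWord a (n + 1) = (List.range (cont a (n + 1))).map (charWord a) := by
  refine List.ext_getElem? fun k => ?_
  rcases lt_or_ge k (cont a (n + 1)) with h | h
  · rw [stdWord_succ_getElem? h]
    simp [h]
  · rw [List.getElem?_eq_none (by rwa [length_stdWord]), List.getElem?_eq_none (by simpa)]

theorem sum_map_stdWord_succ (n : ℕ) : ((stdWord a (n + 1)).map Fin.val).sum =
    ∑ k ∈ Finset.range (cont a (n + 1)), (charWord a k : ℕ) := by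
  rw [stdWord_succ_eq, List.map_map]
  rfl

theorem _root_.Function.Periodic.sum_range_mul {f : ℕ → ℕ} {q : ℕ} (hf : Function.Periodic f q) :
    ∀ d, ∑ k ∈ Finset.range (d * q), f k = d * ∑ k ∈ Finset.range q, f k
  | 0 => by simp
  | d + 1 => by
    rw [Nat.succ_mul, Finset.sum_range_add, hf.sum_range_mul d, Nat.succ_mul]
    refine congrArg _ (Finset.sum_congr rfl fun k _ => ?_)
    rw [add_comm]
    exact hf.nat_mul d k

theorem _root_.Function.Periodic.sum_range_add {f : ℕ → ℕ} {q : ℕ} (hf : Function.Periodic f q) :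
    ∀ i, ∑ k ∈ Finset.range q, f (i + k) = ∑ k ∈ Finset.range q, f k
  | 0 => by simp
  | i + 1 => by
    rw [← hf.sum_range_add i]
    have h1 := Finset.sum_range_succ (fun k => f (i + k)) q
    rw [Finset.sum_range_succ'] at h1
    simp only [add_zero, hf i] at h1
    rw [← Nat.add_right_cancel h1]
    exact Finset.sum_congr rfl fun k _ => by congr 1; ring

/-- The factors of length `q_n - 1` of the characteristic word at the positions smaller than `q_n`
are distinct. -/
theorem charWord_factors_ne {n i j : ℕ} (hij : i < j) (hj : j < cont a n) :
    ∃ t, t + 1 < cont a n ∧ charWord a (i + t) ≠ charWord a (j + t) := by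
  by_contra! hc
  set q := cont a n with hq
  -- The `q`-periodic extension of the prefix of length `q`. It agrees with the characteristic word
  -- on the first `2q - 2` letters, which cover both factors.
  let f : ℕ → ℕ := fun k => (charWord a (k % q) : ℕ)
  have hf : Function.Periodic f q := fun k => by simp [f]
  have hq1 : q ≤ cont a (n + 1) := cont_le_succ n
  have hfc : ∀ k, k + 2 < 2 * q → f k = (charWord a k : ℕ) := fun k hk => by
    rcases lt_or_ge k q with h | h
    · simp [f, Nat.mod_eq_of_lt h]
    · obtain ⟨k, rfl⟩ := Nat.exists_eq_add_of_le' h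
      rw [hf, charWord_add_cont (by omega)]
      simp [f, Nat.mod_eq_of_lt (show k < q by omega)]
  have h1 : ∀ t, t + 1 < q → f (i + t) = f (j + t) := fun t ht => by
    rw [hfc _ (by omega), hfc _ (by omega), hc t ht]
  obtain ⟨r, hr⟩ : ∃ r, q = r + 1 := ⟨q - 1, by omega⟩
  -- All windows of length `q` contain equally many ones, which recovers the last letter.
  have h2 : ∀ t, t < q → f (i + t) = f (j + t) := fun t ht => by
    rcases eq_or_lt_of_le (show t ≤ r by omega) with h | h
    · have h3 := (hf.sum_range_add i).trans (hf.sum_range_add j).symm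
      rw [hr, Finset.sum_range_succ, Finset.sum_range_succ,
        Finset.sum_congr rfl fun t ht => h1 t (by rw [Finset.mem_range] at ht; omega)] at h3
      rw [h]
      exact Nat.add_left_cancel h3
    · exact h1 t (by omega)
  have h3 : ∀ t, f (i + t) = f (j + t) := fun t => by
    have e : ∀ m, f (m + t % q) = f (m + t) := fun m => by simp [f]
    rw [← e, ← e, h2 _ (Nat.mod_lt _ (by omega))]
  have h4 : Function.Periodic f (j - i) := fun k => by
    have := h3 (k + q - i)
    rw [show i + (k + q - i) = k + q by omega,
      show j + (k + q - i) = k + (j - i) + q by omega, hf, hf] at this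
    exact this.symm
  -- Counting ones over `(j - i) q` letters with either period shows that `q` divides `j - i` times
  -- the number of ones in `s_n`. By coprimality `q` divides `j - i`, although `0 < j - i < q`.
  have h5 := hf.sum_range_mul (j - i)
  rw [mul_comm, h4.sum_range_mul q] at h5
  rcases n with _ | n
  · have : q = 1 := rfl
    omega
  have h6 : ∑ k ∈ Finset.range q, f k = ((stdWord a (n + 1)).map Fin.val).sum := by
    rw [sum_map_stdWord_succ]
    exact Finset.sum_congr rfl fun k hk => by
      simp only [f, Nat.mod_eq_of_lt (show k < q from Finset.mem_range.1 hk)]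
  rw [h6] at h5
  have h7 := (coprime_cont_sum a (n + 1)).dvd_of_dvd_mul_right (Dvd.intro _ h5)
  have := Nat.le_of_dvd (by omega) h7
  omega

namespace AlphaNumber

/-! ### Formal intercepts -/

theorem comp_succ (ρ : AlphaNumber a) (n : ℕ) :
    ρ.comp (n + 1) = ρ.digit n * cont a n + ρ.comp n := by
  conv_rhs => rw [← ρ.compat n]
  exact (Nat.div_add_mod' _ _).symm

theorem comp_mono (ρ : AlphaNumber a) : Monotone ρ.comp :=
  monotone_nat_of_le_succ fun n => by rw [comp_succ]; omega

/-- Successive components differ by multiples of `q_m`, a period of the prefix in which these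
letters lie. -/
theorem charWord_comp_add_of_le (ρ : AlphaNumber a) {n m t : ℕ} (h : n ≤ m)
    (ht : t + 1 < cont a n) : charWord a (ρ.comp m + t) = charWord a (ρ.comp n + t) := by
  induction m, h using Nat.le_induction with
  | base => rfl
  | succ m hm ih =>
    have h1 : cont a n ≤ cont a m := cont_mono hm
    have h2 := ρ.lt (m + 1)
    rw [comp_succ] at h2
    rw [← ih, comp_succ, show ρ.digit m * cont a m + ρ.comp m + t =
      ρ.comp m + t + ρ.digit m * cont a m by ring, charWord_add_mul_cont (by omega)]

theorem isIntercept_iff {ρ : AlphaNumber a} {x : ℕ → Fin 2} :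
    ρ.IsIntercept x ↔ ∀ t, ∀ᶠ n in atTop, charWord a (ρ.comp n + t) = x t := by
  simp only [IsIntercept, tendsto_pi_nhds, nhds_discrete, tendsto_pure, shift]

/-- The word `T^ρ(c_α)`. -/
def word (ρ : AlphaNumber a) (t : ℕ) : Fin 2 := charWord a (ρ.comp (t + 2) + t)

theorem charWord_comp_add (ρ : AlphaNumber a) {n t : ℕ} (ht : t + 1 < cont a n) :
    charWord a (ρ.comp n + t) = ρ.word t := by
  have h2 : t + 1 < cont a (t + 2) := by have := le_cont a (t + 2); omega
  rcases le_total n (t + 2) with h | h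
  · exact (ρ.charWord_comp_add_of_le h ht).symm
  · exact ρ.charWord_comp_add_of_le h h2

theorem isIntercept_word (ρ : AlphaNumber a) : ρ.IsIntercept ρ.word :=
  isIntercept_iff.2 fun t => (tendsto_cont.eventually_gt_atTop (t + 1)).mono fun _ hn =>
    ρ.charWord_comp_add hn

theorem isIntercept_iff_eq {ρ : AlphaNumber a} {x : ℕ → Fin 2} :
    ρ.IsIntercept x ↔ x = ρ.word :=
  ⟨fun h => tendsto_nhds_unique h ρ.isIntercept_word, fun h => h ▸ ρ.isIntercept_word⟩

theorem word_injective : Function.Injective (word : AlphaNumber a → ℕ → Fin 2) := by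
  intro ρ γ h
  ext n
  have key : ∀ t, t + 1 < cont a n → charWord a (ρ.comp n + t) = charWord a (γ.comp n + t) :=
    fun t ht => by rw [charWord_comp_add _ ht, charWord_comp_add _ ht, h]
  rcases lt_trichotomy (ρ.comp n) (γ.comp n) with hlt | heq | hlt
  · obtain ⟨t, ht, hne⟩ := charWord_factors_ne hlt (γ.lt n)
    exact absurd (key t ht) hne
  · exact heq
  · obtain ⟨t, ht, hne⟩ := charWord_factors_ne hlt (ρ.lt n)
    exact absurd (key t ht).symm hne

theorem isAdd_iff {ρ σ : AlphaNumber a} {k : ℕ} : ρ.IsAdd k σ ↔ σ.word = shift k ρ.word := by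
  simp only [IsAdd, isIntercept_iff_eq, exists_eq_left, eq_comm]

/-! ### Constructing and comparing `α`-numbers -/

/-- A tail of compatible components suffices, since the earlier ones are obtained by reduction. -/
theorem exists_comp_eq {N : ℕ} {R : ℕ → ℕ} (h1 : ∀ n, N ≤ n → R n < cont a n)
    (h2 : ∀ n, N ≤ n → R (n + 1) % cont a n = R n) :
    ∃ ρ : AlphaNumber a, ∀ n, N ≤ n → ρ.comp n = R n := by
  induction N generalizing R with
  | zero => exact ⟨⟨R, fun n => h1 n n.zero_le, fun n => h2 n n.zero_le⟩, fun _ _ => rfl⟩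
  | succ N ih =>
    obtain ⟨ρ, hρ⟩ := ih (R := fun n => if n = N then R (N + 1) % cont a N else R n)
      (fun n hn => by
        split_ifs with h
        · exact h ▸ Nat.mod_lt _ (cont_pos a n)
        · exact h1 n (by omega))
      (fun n hn => by
        rw [if_neg (by omega)]
        split_ifs with h
        · rw [h]
        · exact h2 n (by omega))
    exact ⟨ρ, fun n hn => by rw [hρ n (by omega), if_neg (by omega)]⟩

theorem comp_eq_of_le {ρ γ : AlphaNumber a} {n m : ℕ} (h : n ≤ m)
    (hm : ρ.comp m = γ.comp m) : ρ.comp n = γ.comp n := by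
  induction m, h using Nat.le_induction with
  | base => exact hm
  | succ m _ ih => exact ih (by rw [← ρ.compat m, ← γ.compat m, hm])

theorem eq_of_frequently {ρ γ : AlphaNumber a} (h : ∃ᶠ n in atTop, ρ.comp n = γ.comp n) :
    ρ = γ := by
  ext n
  obtain ⟨m, hm, he⟩ := frequently_atTop.1 h n
  exact comp_eq_of_le hm he

theorem proj_comp (ρ : AlphaNumber a) (n : ℕ) : ∀ d, proj a n d (ρ.comp (n + d)) = ρ.comp n
  | 0 => rfl
  | d + 1 => by
    rw [proj, ← add_assoc, ρ.compat, proj_comp]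

/-! ### Equivalence of `α`-numbers -/

theorem isAdd_zero (ρ : AlphaNumber a) : ρ.IsAdd 0 ρ :=
  isAdd_iff.2 (funext fun t => by simp [shift])

theorem Equivalent.symm {ρ γ : AlphaNumber a} : ρ.Equivalent γ → γ.Equivalent ρ :=
  fun ⟨k, l, σ, h1, h2⟩ => ⟨l, k, σ, h2, h1⟩

theorem isAdd_of_eventually {ρ σ : AlphaNumber a} {k : ℕ}
    (h : ∀ᶠ n in atTop, σ.comp n = ρ.comp n + k) : ρ.IsAdd k σ := by
  refine isAdd_iff.2 (funext fun t => ?_)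
  obtain ⟨n, hn, hlt⟩ := (h.and ((tendsto_cont (a := a)).eventually_gt_atTop (k + t + 1))).exists
  rw [shift, ← σ.charWord_comp_add (n := n) (by omega), ← ρ.charWord_comp_add hlt, hn, add_assoc]

/-- Once `ρ_n + k < q_n`, the integers `ρ_n + k` are themselves compatible. They define an
`α`-number with the same word as `σ`, hence equal to `σ`. -/
theorem eventually_of_isAdd {ρ σ : AlphaNumber a} {k : ℕ} (h : ρ.IsAdd k σ)
    (hk : ∀ᶠ n in atTop, ρ.comp n + k < cont a n) :
    ∀ᶠ n in atTop, σ.comp n = ρ.comp n + k := by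
  obtain ⟨N, hN⟩ := eventually_atTop.1 hk
  obtain ⟨τ, hτ⟩ := exists_comp_eq hN fun n hn => by
    rw [comp_succ, add_assoc, add_comm, Nat.add_mul_mod_self_right, Nat.mod_eq_of_lt (hN n hn)]
  have h2 : ∀ᶠ n in atTop, τ.comp n = ρ.comp n + k := eventually_atTop.2 ⟨N, hτ⟩
  have h3 : σ = τ := word_injective (by
    rw [isAdd_iff.1 h, isAdd_iff.1 (isAdd_of_eventually h2)])
  rwa [h3]

theorem equivalent_of_eventually {ρ γ : AlphaNumber a} {d : ℤ}
    (h : ∀ᶠ n in atTop, (ρ.comp n : ℤ) = γ.comp n + d) : ρ.Equivalent γ := by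
  rcases le_total 0 d with hd | hd
  · lift d to ℕ using hd
    exact ⟨0, d, ρ, ρ.isAdd_zero, isAdd_of_eventually (h.mono fun n hn => by omega)⟩
  · obtain ⟨e, rfl⟩ := Int.exists_eq_neg_ofNat hd
    exact ⟨e, 0, γ, isAdd_of_eventually (h.mono fun n hn => by omega), γ.isAdd_zero⟩

/-- The numbers `ρ_n` and `q_n - ρ_n` tend to infinity: this characterises the `α`-numbers of
non-zero class. -/
def IsNonzeroClass (ρ : AlphaNumber a) : Prop :=
  ∀ k, ∀ᶠ n in atTop, k < ρ.comp n ∧ ρ.comp n + k < cont a n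

theorem IsNonzeroClass.not_equivalent_zero {ρ : AlphaNumber a} (h : ρ.IsNonzeroClass) :
    ¬ ρ.Equivalent 0 := by
  rintro ⟨k, l, σ, h1, h2⟩
  have h3 := eventually_of_isAdd h1 ((h k).mono fun n hn => hn.2)
  have h4 := eventually_of_isAdd h2 (((tendsto_cont (a := a)).eventually_gt_atTop l).mono fun n hn => by
    change 0 + l < _
    omega)
  obtain ⟨n, ⟨hn3, hn4⟩, hn5⟩ := ((h3.and h4).and (h l)).exists
  have : (0 : AlphaNumber a).comp n = 0 := rfl
  omega

/-- Shifting by `j` leads to the position `q_n`, where the period `q_n` makes the characteristic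
word start again. -/
theorem equivalent_zero_of_frequently {ρ : AlphaNumber a} {j : ℕ}
    (h : ∃ᶠ n in atTop, ρ.comp n + j = cont a n) : ρ.Equivalent 0 := by
  refine ⟨j, 0, 0, isAdd_iff.2 (funext fun t => ?_), isAdd_zero 0⟩
  obtain ⟨n, hn, hlt⟩ :=
    (h.and_eventually ((tendsto_cont (a := a)).eventually_gt_atTop (j + t + 2))).exists
  have h1 := cont_le_succ (a := a) n
  rw [shift, ← ρ.charWord_comp_add (n := n) (by omega),
    ← (0 : AlphaNumber a).charWord_comp_add (n := n) (by omega), ← add_assoc, hn, add_comm (cont a n),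
    charWord_add_cont (by omega)]
  exact congrArg _ (zero_add t)

theorem isNonzeroClass_of_not_equivalent_zero {ρ : AlphaNumber a} (h : ¬ ρ.Equivalent 0) :
    ρ.IsNonzeroClass := by
  intro k
  refine Eventually.and ?_ ?_
  · by_contra hc
    rw [not_eventually] at hc
    have hb : ∀ n, ρ.comp n ≤ k := fun n => by
      obtain ⟨m, hm, hmk⟩ := frequently_atTop.1 hc n
      exact (ρ.comp_mono hm).trans (not_lt.1 hmk)
    obtain ⟨N, hN⟩ : ∃ N, ∀ n, ρ.comp n ≤ ρ.comp N := by
      obtain ⟨_, ⟨N, rfl⟩, hN⟩ := (Set.finite_Iic k |>.subset (Set.range_subset_iff.2 hb)).exists_maximal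
        (Set.range_nonempty ρ.comp)
      exact ⟨N, fun n => (le_total _ _).elim id fun h => hN ⟨n, rfl⟩ h⟩
    refine h (equivalent_of_eventually (d := ρ.comp N) (eventually_atTop.2 ⟨N, fun n hn => ?_⟩))
    rw [le_antisymm (hN n) (ρ.comp_mono hn)]
    exact (zero_add _).symm
  -- For each constant, equality of `ρ_n` plus that constant with `q_n` occurs only finitely often,
  -- so the strict inequality passes from `k` to `k + 1`.
  · induction k with
    | zero => exact Eventually.of_forall ρ.lt
    | succ k ih =>
      have h1 : ∀ᶠ n in atTop, ρ.comp n + (k + 1) ≠ cont a n := by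
        by_contra hc
        rw [not_eventually] at hc
        exact h (equivalent_zero_of_frequently (hc.mono fun n hn => not_not.1 hn))
      filter_upwards [ih, h1] with n h2 h3
      omega

theorem shift_shift (k l : ℕ) (x : ℕ → Fin 2) : shift k (shift l x) = shift (l + k) x :=
  funext fun t => congrArg x (add_assoc l k t).symm

theorem exists_zero_isAdd (a : ℕ → ℕ+) (k : ℕ) : ∃ σ : AlphaNumber a, IsAdd 0 k σ := by
  have h : ∀ n, k + 1 ≤ n → k < cont a n := fun n hn => hn.trans (le_cont a n)
  obtain ⟨σ, hσ⟩ := exists_comp_eq (R := fun _ => k) h fun n hn => Nat.mod_eq_of_lt (h n hn)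
  exact ⟨σ, isAdd_of_eventually (eventually_atTop.2 ⟨k + 1, fun n hn =>
    (hσ n hn).trans (zero_add k).symm⟩)⟩

theorem IsNonzeroClass.of_equivalent {ρ γ : AlphaNumber a} (hρ : ρ.IsNonzeroClass)
    (h : ρ.Equivalent γ) : γ.IsNonzeroClass := by
  refine isNonzeroClass_of_not_equivalent_zero fun h0 => hρ.not_equivalent_zero ?_
  obtain ⟨k, l, σ, h1, h2⟩ := h
  obtain ⟨i, j, τ, h3, h4⟩ := h0
  obtain ⟨μ, hμ⟩ := exists_zero_isAdd a (j + l)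
  refine ⟨k + i, j + l, μ, ?_, hμ⟩
  rw [isAdd_iff] at *
  rw [hμ, ← shift_shift, ← h4, h3, shift_shift, add_comm i, ← shift_shift, ← h2, h1, shift_shift]

theorem Equivalent.exists_eventually {ρ γ : AlphaNumber a} (h : ρ.Equivalent γ)
    (hρ : ρ.IsNonzeroClass) (hγ : γ.IsNonzeroClass) :
    ∃ d : ℤ, ∀ᶠ n in atTop, (γ.comp n : ℤ) = ρ.comp n + d := by
  obtain ⟨k, l, σ, h1, h2⟩ := h
  refine ⟨k - l, ?_⟩
  filter_upwards [eventually_of_isAdd h1 ((hρ k).mono fun n hn => hn.2),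
    eventually_of_isAdd h2 ((hγ l).mono fun n hn => hn.2)] with n h3 h4
  omega

/-! ### Complements -/

/-- At a non-zero digit `Λ(n) = n`, and the projection is a single reduction modulo `q_n`. At the
other indices the condition follows by projecting `σ` from `Λ(n)`. -/
theorem isComplement_iff {ρ σ : AlphaNumber a} (hρ : ∃ᶠ n in atTop, ρ.digit n ≠ 0) :
    ρ.IsComplement σ ↔ ∀ᶠ n in atTop, ρ.digit n ≠ 0 →
      ∃ k, k + 2 + ρ.comp (n + 1) = cont a (n + 1) ∧ k % cont a n = σ.comp n := by
  constructor
  · refine fun h => h.mono fun n hn hd => ?_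
    obtain ⟨m, k, h1, h2, h3⟩ := hn
    obtain rfl : m = n := le_antisymm (h1.2 ⟨le_rfl, hd⟩) h1.1.1
    refine ⟨k, h2, ?_⟩
    rw [h3, Nat.add_sub_cancel_left]
    rfl
  · intro h
    obtain ⟨N, hN⟩ := eventually_atTop.1 h
    refine eventually_atTop.2 ⟨N, fun n hn => ?_⟩
    have hex : ∃ m, n ≤ m ∧ ρ.digit m ≠ 0 := frequently_atTop.1 hρ n
    classical
    obtain ⟨h1, h2⟩ := Nat.find_spec hex
    obtain ⟨d, hd⟩ := Nat.exists_eq_add_of_le h1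
    obtain ⟨k, hk1, hk2⟩ := hN _ (hn.trans h1) h2
    refine ⟨Nat.find hex, k, ⟨Nat.find_spec hex, fun i hi => Nat.find_min' hex hi⟩, hk1, ?_⟩
    rw [hd] at hk2 ⊢
    rw [show n + d + 1 - n = d + 1 by omega, proj, hk2, proj_comp]

theorem IsNonzeroClass.frequently_digit_ne_zero {ρ : AlphaNumber a} (h : ρ.IsNonzeroClass) :
    ∃ᶠ n in atTop, ρ.digit n ≠ 0 := by
  intro hc
  obtain ⟨N, hN⟩ := eventually_atTop.1 hc
  have h1 : ∀ n, N ≤ n → ρ.comp n = ρ.comp N := fun n hn => by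
    induction n, hn using Nat.le_induction with
    | base => rfl
    | succ n hn ih => rw [comp_succ, not_not.1 (hN n hn), ih]; simp
  obtain ⟨n, hn1, hn2⟩ := ((h (ρ.comp N)).and (eventually_ge_atTop N)).exists
  rw [h1 n hn2] at hn1
  exact hn1.1.false

end AlphaNumber

/-! ### The automaton recognising the `B`-factorisations

The states are `0`, `1`, `2`; each letter acts by a permutation, and the factors of a
`B`-factorisation are the return words to the state `1`. -/

/-- The action of a letter on the states. -/
def step (x : Fin 2) (s : Fin 3) : Fin 3 :=
  if s = 0 then 1 else if s = 1 then (if x = 0 then 0 else 2) else (if x = 0 then 2 else 0)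

/-- The state reached from `s` after reading the first `n` letters of `y`. -/
def state (y : ℕ → Fin 2) (s : Fin 3) : ℕ → Fin 3
  | 0 => s
  | n + 1 => step (y n) (state y s n)

theorem step_injective : ∀ x, Function.Injective (step x) := by decide

variable {y : ℕ → Fin 2}

theorem state_injective (y : ℕ → Fin 2) : ∀ n, Function.Injective fun s => state y s n
  | 0 => fun _ _ h => h
  | n + 1 => (step_injective (y n)).comp (state_injective y n)

theorem exists_state_eq (y : ℕ → Fin 2) (n : ℕ) (t : Fin 3) : ∃ s, state y s n = t :=
  Finite.surjective_of_injective (state_injective y n) t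

theorem eq_of_state_eq {s t : Fin 3} {n : ℕ} (h : state y s n = state y t n) : s = t :=
  state_injective y n h

/-- The state follows the automaton from the index `N` on. -/
theorem exists_state_eq_of_step {N : ℕ} {r : ℕ → Fin 3}
    (h : ∀ n, N ≤ n → r (n + 1) = step (y n) (r n)) : ∃ s, ∀ n, N ≤ n → r n = state y s n := by
  obtain ⟨s, hs⟩ := exists_state_eq y N (r N)
  refine ⟨s, fun n hn => ?_⟩
  induction n, hn using Nat.le_induction with
  | base => exact hs.symm
  | succ n hn ih => rw [h n hn, ih, state]

/-- The factor of length `L` of `y` at the position `C` belongs to `B`. -/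
def IsFactorB (y : ℕ → Fin 2) (C L : ℕ) : Prop :=
  (y C = 0 ∧ L = 2) ∨
    ∃ k, y C = 1 ∧ (∀ i < k, y (C + 1 + i) = 0) ∧ y (C + 1 + k) = 1 ∧ L = k + 3

theorem fin_two_eq_one : ∀ {x : Fin 2}, x ≠ 0 → x = 1 := by decide

theorem mem_wordsB_iff {C L : ℕ} :
    ((List.range L).map fun i => y (C + i)) ∈ wordsB ↔ IsFactorB y C L := by
  have hxy : ∀ x : Fin 2, x = 0 ∨ x = 1 := by decide
  constructor
  · intro h
    generalize hu : ((List.range L).map fun i => y (C + i)) = u at h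
    have hL : u.length = L := by simp [← hu]
    have hget : ∀ i < L, u[i]? = some (y (C + i)) := fun i hi => by simp [← hu, hi]
    have one : ∀ k x, u = 1 :: (List.replicate k 0 ++ [1, x]) → IsFactorB y C L := by
      rintro k x rfl
      simp only [List.length_cons, List.length_append, List.length_replicate, List.length_nil] at hL
      refine Or.inr ⟨k, ?_, fun i hi => ?_, ?_, by omega⟩
      · have := hget 0 (by omega)
        simpa using this.symm
      · have := hget (1 + i) (by omega)
        rw [add_comm 1 i, List.getElem?_cons_succ,
          List.getElem?_append_left (by simpa), List.getElem?_replicate_of_lt hi] at this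
        rw [add_assoc, add_comm 1 i]
        exact (Option.some.inj this).symm
      · have := hget (1 + k) (by omega)
        rw [add_comm 1 k, List.getElem?_cons_succ,
          List.getElem?_append_right (by simp)] at this
        rw [add_assoc, add_comm 1 k]
        simpa using this.symm
    have zero : ∀ x, u = [0, x] → IsFactorB y C L := by
      rintro x rfl
      have := hget 0 (by simp at hL; omega)
      exact Or.inl ⟨by simpa using this.symm, hL.symm⟩
    rcases h with (h | h) | ⟨k, h | h⟩
    exacts [zero _ h, zero _ h, one _ _ h, one _ _ h]
  · rintro (⟨h1, rfl⟩ | ⟨k, h1, h2, h3, rfl⟩)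
    · rcases hxy (y (C + 1)) with h | h
      · exact Or.inl (Or.inl (by simp [List.range_succ, h1, h]))
      · exact Or.inl (Or.inr (by simp [List.range_succ, h1, h]))
    · have e : ((List.range (k + 3)).map fun i => y (C + i)) =
          1 :: (List.replicate k 0 ++ [1, y (C + k + 2)]) := by
        rw [show k + 3 = (k + 2) + 1 from rfl, List.range_succ_eq_map, List.range_succ,
          List.range_succ]
        have e2 : (List.range k).map (fun i => y (C + (i + 1))) = List.replicate k 0 := by
          refine List.eq_replicate_iff.2 ⟨by simp, fun b hb => ?_⟩
          obtain ⟨i, hi, rfl⟩ := List.mem_map.1 hb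
          rw [add_comm i 1, ← add_assoc]
          exact h2 i (List.mem_range.1 hi)
        simp only [List.map_cons, List.map_append, List.map_map, Function.comp_def, List.map_nil,
          Nat.succ_eq_add_one, add_zero, h1, List.append_assoc, e2]
        rw [show C + (k + 1) = C + 1 + k by ring, h3]
        rfl
      rw [e]
      rcases hxy (y (C + k + 2)) with h | h
      · exact Or.inr ⟨k, Or.inl (by rw [h])⟩
      · exact Or.inr ⟨k, Or.inr (by rw [h])⟩

theorem state_succ_of_zero {s : Fin 3} {n : ℕ} (h : state y s n = 0) : state y s (n + 1) = 1 := by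
  simp [state, h, step]

theorem state_add_of_two {s : Fin 3} {n : ℕ} (h : state y s n = 2) :
    ∀ {k}, (∀ i < k, y (n + i) = 0) → state y s (n + k) = 2
  | 0, _ => h
  | k + 1, hk => by
    rw [← add_assoc, state, state_add_of_two h fun i hi => hk i (by omega), hk k (by omega)]
    rfl

theorem IsFactorB.two_le {C L : ℕ} (h : IsFactorB y C L) : 2 ≤ L := by
  rcases h with ⟨_, rfl⟩ | ⟨k, _, _, _, rfl⟩ <;> omega

/-- The paths are `1 → 0 → 1` and `1 → 2 → ⋯ → 2 → 0 → 1`. The last letter is free because state `0`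
leads to `1` under both letters. -/
theorem IsFactorB.state {s : Fin 3} {C L : ℕ} (h : IsFactorB y C L) (hC : state y s C = 1) :
    state y s (C + L) = 1 ∧ ∀ i, 0 < i → i < L → state y s (C + i) ≠ 1 := by
  rcases h with ⟨h1, rfl⟩ | ⟨k, h1, h2, h3, rfl⟩
  · have h4 : Sturm.state y s (C + 1) = 0 := by simp [Sturm.state, hC, step, h1]
    refine ⟨state_succ_of_zero h4, fun i hi1 hi2 => ?_⟩
    rw [show i = 1 by omega, h4]
    decide
  · have h4 : Sturm.state y s (C + 1) = 2 := by simp [Sturm.state, hC, step, h1]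
    have h5 : ∀ j ≤ k, Sturm.state y s (C + 1 + j) = 2 := fun j hj =>
      state_add_of_two h4 fun i hi => h2 i (by omega)
    have h6 : Sturm.state y s (C + 1 + k + 1) = 0 := by
      rw [Sturm.state, h5 k le_rfl, h3]
      rfl
    rw [show C + (k + 3) = C + 1 + k + 1 + 1 by omega]
    refine ⟨state_succ_of_zero h6, fun i hi1 hi2 => ?_⟩
    obtain ⟨j, rfl⟩ := Nat.exists_eq_add_of_lt hi1
    rcases Nat.lt_or_ge k j with h | h
    · rw [show C + (0 + j + 1) = C + 1 + k + 1 by omega, h6]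
      decide
    · rw [show C + (0 + j + 1) = C + 1 + j by omega, h5 j h]
      decide

theorem IsFactorB.length_eq {s : Fin 3} {C L L' : ℕ} (h : IsFactorB y C L) (h' : IsFactorB y C L')
    (hC : Sturm.state y s C = 1) : L = L' := by
  rcases lt_trichotomy L L' with hlt | heq | hlt
  · exact absurd (h.state hC).1 ((h'.state hC).2 L (by have := h.two_le; omega) hlt)
  · exact heq
  · exact absurd (h'.state hC).1 ((h.state hC).2 L' (by have := h'.two_le; omega) hlt)

/-- A factor beginning with `1` needs a later `1`, which is where infinitely many odd partial
quotients are used. -/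
theorem exists_isFactorB (hy : ∃ᶠ n in atTop, y n = 1) (C : ℕ) : ∃ L, IsFactorB y C L := by
  by_cases h0 : y C = 0
  · exact ⟨2, Or.inl ⟨h0, rfl⟩⟩
  · have hex : ∃ k, y (C + 1 + k) = 1 := by
      obtain ⟨m, hm, h⟩ := frequently_atTop.1 hy (C + 1)
      exact ⟨m - (C + 1), by rwa [Nat.add_sub_cancel' hm]⟩
    exact ⟨Nat.find hex + 3, Or.inr ⟨_, fin_two_eq_one h0, fun i hi => by
      by_contra hne
      exact Nat.find_min hex hi (fin_two_eq_one hne), Nat.find_spec hex, rfl⟩⟩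

theorem exists_state_eq_one (hy : ∃ᶠ n in atTop, y n = 1) (s : Fin 3) : ∃ n, state y s n = 1 := by
  have h0 : ∀ n, state y s n = 0 → ∃ n, state y s n = 1 := fun n h => ⟨_, state_succ_of_zero h⟩
  have h3 : ∀ t : Fin 3, t = 0 ∨ t = 1 ∨ t = 2 := by decide
  obtain ⟨k, hk⟩ := hy.exists
  rcases h3 (state y s k) with h | h | h
  · exact h0 k h
  · exact ⟨k, h⟩
  · exact h0 (k + 1) (by rw [state, h, hk]; rfl)

/-! ### Factorisations as sequences of visits to the state `1` -/

namespace BFactorisation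

theorem cut_succ (F : BFactorisation y) (j : ℕ) :
    F.cut (j + 1) = F.cut j + (F.factor j).length := by
  rw [cut, cutAt, Finset.sum_range_succ, ← add_assoc]
  rfl

theorem isFactorB (F : BFactorisation y) (j : ℕ) :
    IsFactorB y (F.cut j) (F.factor j).length := by
  rw [← mem_wordsB_iff]
  have := F.eq j ▸ F.mem j
  exact this

theorem cut_strictMono (F : BFactorisation y) : StrictMono F.cut :=
  strictMono_nat_of_lt_succ fun j => by
    have := (F.isFactorB j).two_le
    rw [cut_succ]
    omega

theorem state_cut {F : BFactorisation y} {s : Fin 3} (hF : state y s F.start = 1) :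
    ∀ j, state y s (F.cut j) = 1
  | 0 => hF
  | j + 1 => by
    rw [cut_succ]
    exact ((F.isFactorB j).state (state_cut hF j)).1

theorem exists_cut_eq {F : BFactorisation y} {s : Fin 3} (hF : state y s F.start = 1) {n : ℕ}
    (hn : F.start ≤ n) (h : state y s n = 1) : ∃ j, n = F.cut j := by
  have hex : ∃ j, n < F.cut j := ⟨n + 1, (F.cut_strictMono.id_le (n + 1))⟩
  obtain ⟨j, hj⟩ : ∃ j, Nat.find hex = j + 1 := Nat.exists_eq_succ_of_ne_zero fun h0 => by
    have := Nat.find_spec hex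
    rw [h0] at this
    exact absurd this (not_lt.2 hn)
  have h1 : n < F.cut (j + 1) := hj ▸ Nat.find_spec hex
  have h2 : F.cut j ≤ n := not_lt.1 (Nat.find_min hex (m := j) (by omega))
  refine ⟨j, ?_⟩
  by_contra hne
  rw [cut_succ] at h1
  refine ((F.isFactorB j).state (state_cut hF j)).2 (n - F.cut j) (by omega) (by omega) ?_
  rwa [Nat.add_sub_cancel' h2]

theorem isTail_of_le {F G : BFactorisation y} {s : Fin 3} (hF : state y s F.start = 1)
    (hG : state y s G.start = 1) (h : F.start ≤ G.start) : F.IsTail G := by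
  obtain ⟨l, hl⟩ := exists_cut_eq hF h hG
  have hlen : ∀ j, G.cut j = F.cut (j + l) → (G.factor j).length = (F.factor (j + l)).length :=
    fun j hj => (hj ▸ G.isFactorB j).length_eq (F.isFactorB (j + l)) (state_cut hF _)
  have hcut : ∀ j, G.cut j = F.cut (j + l) := fun j => by
    induction j with
    | zero => rw [zero_add, ← hl]; rfl
    | succ j ih => rw [cut_succ, hlen j ih, ih, Nat.add_right_comm, cut_succ]
  refine ⟨l, hl, fun j => ?_⟩
  rw [G.eq, F.eq, hlen j (hcut j)]
  have := hcut j
  rw [cut, cut] at this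
  rw [this]

theorem eq_of_isTail {F G : BFactorisation y} {s t : Fin 3} (hF : state y s F.start = 1)
    (hG : state y t G.start = 1) (h : F.IsTail G) : s = t := by
  obtain ⟨l, hl, -⟩ := h
  exact eq_of_state_eq (n := G.start) (by rw [hG, hl, state_cut hF])

theorem equivalent_iff {F G : BFactorisation y} {s t : Fin 3} (hF : state y s F.start = 1)
    (hG : state y t G.start = 1) : F.Equivalent G ↔ s = t := by
  constructor
  · rintro (h | h)
    exacts [eq_of_isTail hF hG h, (eq_of_isTail hG hF h).symm]
  · rintro rfl
    exact (le_total F.start G.start).imp (isTail_of_le hF hG) (isTail_of_le hG hF)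

theorem exists_of_state (hy : ∃ᶠ n in atTop, y n = 1) (s : Fin 3) :
    ∃ F : BFactorisation y, state y s F.start = 1 := by
  obtain ⟨n, hn⟩ := exists_state_eq_one hy s
  choose L hL using exists_isFactorB hy
  let c : ℕ → ℕ := fun j => Nat.rec n (fun _ C => C + L C) j
  let u : ℕ → List (Fin 2) := fun j => (List.range (L (c j))).map fun i => y (c j + i)
  have hlen : ∀ j, (u j).length = L (c j) := fun j => by simp [u]
  have hc : ∀ j, cutAt n u j = c j := fun j => by
    induction j with
    | zero => rfl
    | succ j ih =>
      rw [cutAt, Finset.sum_range_succ, ← add_assoc, ← cutAt, ih, hlen]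
  exact ⟨⟨n, u, fun j => mem_wordsB_iff.2 (hL _), fun j => by rw [hc, hlen]⟩, hn⟩

end BFactorisation

/-! ### The linear forms attached to the states -/

theorem cont_succ_eq (n : ℕ) : cont a (n + 1) = (a n : ℕ) * cont a n + contShift a n := rfl

/-- These are the gaps between the three forms `q_{n-1}`, `q_n`, `q_n + q_{n-1}`; they exceed any
constant. -/
theorem eventually_contShift (K : ℕ) :
    ∀ᶠ n in atTop, K < contShift a n ∧ contShift a n + K < cont a n := by
  refine eventually_atTop.2 ⟨K + 3, fun n hn => ?_⟩
  obtain ⟨m, rfl⟩ := Nat.exists_eq_add_of_le' (show 2 ≤ n by omega)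
  change K < cont a (m + 1) ∧ cont a (m + 1) + K < cont a (m + 2)
  have h1 := le_cont a (m + 1)
  have h2 := le_cont a m
  have h3 := cont_add_le (a := a) m
  omega

/-- The value at `n` of the linear form `q_n`, `q_{n-1}` or `q_n + q_{n-1}` attached to a state. -/
def val (a : ℕ → ℕ+) (n : ℕ) (s : Fin 3) : ℕ :=
  if s = 0 then cont a n else if s = 1 then contShift a n else cont a n + contShift a n

theorem val_zero (n : ℕ) : val a n 0 = cont a n := rfl

theorem val_one (n : ℕ) : val a n 1 = contShift a n := rfl

theorem val_two (n : ℕ) : val a n 2 = cont a n + contShift a n := rfl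

theorem fin_three_cases : ∀ s : Fin 3, s = 0 ∨ s = 1 ∨ s = 2 := by decide

theorem val_le (n : ℕ) (s : Fin 3) : val a n s ≤ cont a n + contShift a n := by
  rcases fin_three_cases s with rfl | rfl | rfl
  · rw [val_zero]; omega
  · rw [val_one]; omega
  · rw [val_two]

/-- Half of the increment of the linear form, in units of `q_n`, when the state changes. -/
def stateDigit (a : ℕ → ℕ+) (n : ℕ) (s : Fin 3) : ℕ :=
  if s = 0 then 0 else if s = 1 then ((a n : ℕ) + 1) / 2 else (a n : ℕ) / 2

theorem parityWord_of_even {n : ℕ} (h : Even (a n : ℕ)) : parityWord a n = 0 :=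
  Fin.ext (Nat.even_iff.1 h)

theorem parityWord_of_odd {n : ℕ} (h : ¬ Even (a n : ℕ)) : parityWord a n = 1 :=
  Fin.ext (Nat.not_even_iff.1 h)

/-- The automaton is designed for this identity: from each state and parity, exactly one form at `n
+ 1` exceeds the present one by an even multiple of `q_n`. -/
theorem val_step (n : ℕ) (s : Fin 3) : val a (n + 1) (step (parityWord a n) s) =
    2 * (stateDigit a n s * cont a n) + val a n s := by
  have hQ : contShift a (n + 1) = cont a n := rfl
  by_cases h : Even (a n : ℕ)
  · rw [parityWord_of_even h]
    obtain ⟨m, hm⟩ := h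
    have e1 : ((a n : ℕ) + 1) / 2 = m := by omega
    have e2 : (a n : ℕ) / 2 = m := by omega
    rcases fin_three_cases s with rfl | rfl | rfl
    · change contShift a (n + 1) = 2 * (0 * cont a n) + cont a n
      rw [hQ]; ring
    · change cont a (n + 1) = 2 * ((((a n : ℕ) + 1) / 2) * cont a n) + contShift a n
      rw [e1, cont_succ_eq, hm]; ring
    · change cont a (n + 1) + contShift a (n + 1) =
        2 * (((a n : ℕ) / 2) * cont a n) + (cont a n + contShift a n)
      rw [e2, cont_succ_eq, hQ, hm]; ring
  · rw [parityWord_of_odd h]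
    obtain ⟨m, hm⟩ := Nat.not_even_iff_odd.1 h
    have e1 : ((a n : ℕ) + 1) / 2 = m + 1 := by omega
    have e2 : (a n : ℕ) / 2 = m := by omega
    rcases fin_three_cases s with rfl | rfl | rfl
    · change contShift a (n + 1) = 2 * (0 * cont a n) + cont a n
      rw [hQ]; ring
    · change cont a (n + 1) + contShift a (n + 1) =
        2 * ((((a n : ℕ) + 1) / 2) * cont a n) + contShift a n
      rw [e1, cont_succ_eq, hQ, hm]; ring
    · change cont a (n + 1) = 2 * (((a n : ℕ) / 2) * cont a n) + (cont a n + contShift a n)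
      rw [e2, cont_succ_eq, hm]; ring

theorem eq_of_val_sub_lt {n K : ℕ} {s t : Fin 3}
    (hK : K < contShift a n ∧ contShift a n + K < cont a n)
    (h1 : val a n s ≤ val a n t + K) (h2 : val a n t ≤ val a n s + K) : s = t := by
  rcases fin_three_cases s with rfl | rfl | rfl <;> rcases fin_three_cases t with rfl | rfl | rfl <;>
    simp only [val_zero, val_one, val_two] at h1 h2 <;> first | rfl | (exfalso; omega)

theorem not_mul_eq_of_lt {q c w : ℤ} (h0 : 0 < q) (h1 : q < c) : q ≠ w * c := by
  rintro rfl
  have h2 : 0 < w := pos_of_mul_pos_left h0 (by linarith)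
  nlinarith

/-- Modulo `2q_n` the three forms at `n + 1` are distinct: two of the differences are `±q_{n-1}`
modulo `q_n`, and the third is `q_n`. -/
theorem eq_of_val_sub_eq {n : ℕ} {s t : Fin 3} {z : ℤ}
    (hQ : 0 < contShift a n ∧ contShift a n < cont a n)
    (h : (val a (n + 1) s : ℤ) = val a (n + 1) t + 2 * (z * cont a n)) : s = t := by
  have h0 : (0 : ℤ) < contShift a n := by exact_mod_cast hQ.1
  have h1 : (contShift a n : ℤ) < cont a n := by exact_mod_cast hQ.2
  have hne : ∀ w : ℤ, (contShift a n : ℤ) ≠ w * cont a n := fun w => not_mul_eq_of_lt h0 h1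
  have hc : (cont a n : ℤ) ≠ 0 := by linarith
  have hodd : ∀ w : ℤ, (2 * w + 1) * (cont a n : ℤ) ≠ 0 := fun w =>
    mul_ne_zero (by omega) hc
  have e1 : (cont a (n + 1) : ℤ) = (a n : ℕ) * cont a n + contShift a n := by
    exact_mod_cast cont_succ_eq n
  have e2 : contShift a (n + 1) = cont a n := rfl
  rcases fin_three_cases s with rfl | rfl | rfl <;> rcases fin_three_cases t with rfl | rfl | rfl <;>
    simp only [val_zero, val_one, val_two, e2, Nat.cast_add, e1] at h
  · rfl
  · exact (hne (1 + 2 * z - (a n : ℕ)) (by linear_combination h)).elim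
  · exact (hodd z (by linear_combination -h)).elim
  · exact (hne (1 - 2 * z - (a n : ℕ)) (by linear_combination -h)).elim
  · rfl
  · exact (hne (- 2 * z - (a n : ℕ)) (by linear_combination -h)).elim
  · exact (hodd (-z) (by linear_combination h)).elim
  · exact (hne (2 * z - (a n : ℕ)) (by linear_combination h)).elim
  · rfl

/-! ### Numbers following a state sequence, and numbers equivalent to their complement -/

namespace AlphaNumber

/-- For large `n`, the integer `2 ρ_n + e` is the value of the linear form attached to the state
reached from `s`. -/
def HasState (ρ : AlphaNumber a) (e : ℤ) (s : Fin 3) : Prop :=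
  ∀ᶠ n in atTop, 2 * (ρ.comp n : ℤ) + e = val a n (state (parityWord a) s n)

theorem le_val {n : ℕ} (s : Fin 3) (h : contShift a n ≤ cont a n) : contShift a n ≤ val a n s := by
  rcases fin_three_cases s with rfl | rfl | rfl
  · rwa [val_zero]
  · rw [val_one]
  · rw [val_two]; omega

theorem HasState.isNonzeroClass {ρ : AlphaNumber a} {e : ℤ} {s : Fin 3} (h : ρ.HasState e s) :
    ρ.IsNonzeroClass := by
  intro k
  filter_upwards [h, eventually_contShift (a := a) (2 * k + e.natAbs)] with n h1 h2
  have h3 := val_le (a := a) n (state (parityWord a) s n)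
  have h4 := le_val (a := a) (n := n) (state (parityWord a) s n) (by omega)
  omega

theorem HasState.equivalent {ρ γ : AlphaNumber a} {e e' : ℤ} {s : Fin 3} (h : ρ.HasState e s)
    (h' : γ.HasState e' s) : ρ.Equivalent γ := by
  refine equivalent_of_eventually (d := (e' - e) / 2) ?_
  filter_upwards [h, h'] with n h1 h2
  omega

theorem HasState.state_eq {ρ γ : AlphaNumber a} {e e' : ℤ} {s t : Fin 3} (h : ρ.HasState e s)
    (h' : γ.HasState e' t) (heq : ρ.Equivalent γ) : s = t := by
  obtain ⟨d, hd⟩ := heq.exists_eventually h.isNonzeroClass h'.isNonzeroClass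
  obtain ⟨n, ⟨⟨h1, h2⟩, h3⟩, h4⟩ := (((h.and h').and hd).and
    (eventually_contShift (a := a) (2 * d + e' - e).natAbs)).exists
  exact eq_of_state_eq (y := parityWord a) (n := n) (eq_of_val_sub_lt h4 (by omega) (by omega))

theorem comp_succ_eq_of_digit_eq_zero {ρ : AlphaNumber a} {n : ℕ} (h : ρ.digit n = 0) :
    ρ.comp (n + 1) = ρ.comp n := by
  rw [comp_succ, h, zero_mul, zero_add]

theorem HasState.equivalentToComplement {ρ : AlphaNumber a} {e : ℤ} {s : Fin 3}
    (h : ρ.HasState e s) : ρ.EquivalentToComplement := by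
  have hnz := h.isNonzeroClass
  obtain ⟨N, hN⟩ := eventually_atTop.1 (hnz (e.natAbs + 2))
  -- The shift `e - 2` is forced: modulo `q_n` the complement is `q_{n-1} - 2 - ρ_n`, and `2ρ_n + e
  -- ≡ q_{n-1}` in the states `1` and `2`.
  obtain ⟨σ, hσ⟩ := exists_comp_eq (a := a) (N := N)
    (R := fun n => ((ρ.comp n : ℤ) + (e - 2)).toNat)
    (fun n hn => by have := hN n hn; omega)
    (fun n hn => by
      have h1 := hN n hn
      have h2 := hN (n + 1) (by omega)
      have h3 := ρ.comp_succ n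
      rw [show ((ρ.comp (n + 1) : ℤ) + (e - 2)).toNat =
        ((ρ.comp n : ℤ) + (e - 2)).toNat + ρ.digit n * cont a n by omega,
        Nat.add_mul_mod_self_right, Nat.mod_eq_of_lt (by omega)])
  have hσ' : ∀ᶠ n in atTop, (σ.comp n : ℤ) = ρ.comp n + (e - 2) :=
    eventually_atTop.2 ⟨N, fun n hn => by
      have := hN n hn
      rw [hσ n hn]
      omega⟩
  refine ⟨σ, (isComplement_iff hnz.frequently_digit_ne_zero).2 ?_,
    (equivalent_of_eventually hσ').symm⟩
  filter_upwards [hσ', h, (tendsto_add_atTop_nat 1).eventually h,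
    (tendsto_add_atTop_nat 1).eventually (hnz 2)] with n h1 h2 h3 h4 hd
  obtain ⟨k, hk⟩ := Nat.exists_eq_add_of_le' (show 2 + ρ.comp (n + 1) ≤ cont a (n + 1) by omega)
  refine ⟨k, by omega, ?_⟩
  have h5 := ρ.comp_succ n
  have hk' : (k : ℤ) = (a n : ℕ) * cont a n + contShift a n - 2 - ρ.digit n * cont a n -
      ρ.comp n := by
    have e1 := cont_succ_eq (a := a) n
    zify at hk e1 h5
    linarith
  have key : ∃ z : ℤ, (k : ℤ) = σ.comp n + z * cont a n := by
    rcases fin_three_cases (state (parityWord a) s n) with hs | hs | hs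
    -- State `0` is followed by state `1` with the same value `q_n`, so the digit would vanish.
    · refine absurd ?_ hd
      rw [hs, val_zero] at h2
      rw [state_succ_of_zero hs, val_one] at h3
      change _ = (cont a n : ℤ) at h3
      have : ρ.digit n * cont a n = 0 := by omega
      exact (Nat.mul_eq_zero.1 this).resolve_right (cont_pos a n).ne'
    · rw [hs, val_one] at h2
      exact ⟨(a n : ℕ) - ρ.digit n, by linear_combination hk' - h1 - h2⟩
    · rw [hs, val_two, Nat.cast_add] at h2
      exact ⟨(a n : ℕ) - ρ.digit n - 1, by linear_combination hk' - h1 - h2⟩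
  obtain ⟨z, hz⟩ := key
  have h6 : ((k % cont a n : ℕ) : ℤ) = σ.comp n := by
    rw [Int.natCast_mod, hz, Int.add_mul_emod_self_right]
    exact_mod_cast Nat.mod_eq_of_lt (σ.lt n)
  exact_mod_cast h6

theorem exists_hasState {ρ : AlphaNumber a} (hnz : ρ.IsNonzeroClass)
    (h : ρ.EquivalentToComplement) : ∃ e s, ρ.HasState e s := by
  obtain ⟨σ, hc, heq⟩ := h
  have hfreq := hnz.frequently_digit_ne_zero
  rw [isComplement_iff hfreq] at hc
  have hσ : σ.IsNonzeroClass := hnz.of_equivalent heq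
  obtain ⟨d, hd⟩ := heq.exists_eventually hnz hσ
  obtain ⟨N, hN⟩ := eventually_atTop.1 (((hc.and hd).and (hnz (d + 2).natAbs)).and
    (eventually_contShift (a := a) 0))
  have hb : ∀ n, N ≤ n → 0 < 2 * (ρ.comp n : ℤ) + (d + 2) ∧
      2 * (ρ.comp n : ℤ) + (d + 2) < 2 * cont a n := fun n hn => by
    have := (hN n hn).1.2
    omega
  have hdigit : ∀ n, N ≤ n → ρ.digit n ≠ 0 → ∃ t, 2 * (ρ.comp n : ℤ) + (d + 2) = val a n t := by
    intro n hn h0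
    obtain ⟨⟨⟨h1, h2⟩, -⟩, h3, h4⟩ := hN n hn
    obtain ⟨k, hk1, hk2⟩ := h1 h0
    obtain ⟨hb1, hb2⟩ := hb n hn
    have e1 := cont_succ_eq (a := a) n
    have e2 := ρ.comp_succ n
    have e3 := Nat.mod_add_div k (cont a n)
    rw [hk2] at e3
    zify at hk1 e1 e2 e3 h3 h4
    -- The complement condition, read modulo `q_n`; the bounds `hb` then leave only `w = 0` and `w =
    -- 1`.
    obtain ⟨w, hw⟩ : ∃ w : ℤ, 2 * (ρ.comp n : ℤ) + (d + 2) = contShift a n + w * cont a n :=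
      ⟨(a n : ℕ) - ρ.digit n - (k / cont a n : ℕ), by
        push_cast
        linear_combination hk1 + e1 - e2 + e3 - h2⟩
    have hpos : (0 : ℤ) < cont a n := by linarith
    have hw1 : w < 2 := by nlinarith
    have hw2 : -1 < w := by nlinarith
    obtain rfl | rfl : w = 0 ∨ w = 1 := by omega
    · exact ⟨1, by rw [hw, val_one]; ring⟩
    · exact ⟨2, by rw [hw, val_two]; push_cast; ring⟩
  have hall : ∀ n, N ≤ n → ∃ t, 2 * (ρ.comp n : ℤ) + (d + 2) = val a n t := by
    intro n hn
    -- Descent from the next non-zero digit: through a zero digit `ρ_n` does not change, and only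
    -- the names of the forms do.
    obtain ⟨m, hm, hm0⟩ := frequently_atTop.1 hfreq n
    induction hm using Nat.decreasingInduction with
    | self => exact hdigit m hn hm0
    | of_succ n hnm ih =>
      by_cases h0 : ρ.digit n = 0
      · obtain ⟨t, ht⟩ := ih (by omega)
        obtain ⟨-, h3, h4⟩ := hN n hn
        obtain ⟨hb1, hb2⟩ := hb n hn
        rw [comp_succ_eq_of_digit_eq_zero h0] at ht
        have e1 := cont_succ_eq (a := a) n
        have ha : cont a n ≤ (a n : ℕ) * cont a n := Nat.le_mul_of_pos_left _ (a n).pos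
        rcases fin_three_cases t with rfl | rfl | rfl
        · rw [val_zero] at ht
          refine ⟨2, ?_⟩
          rw [ht, val_two, e1]
          -- The value `q_{n+1}` is below `2q_n`, which forces the partial quotient to be `1` and
          -- `q_{n+1} = q_n + q_{n-1}`.
          obtain h5 | h5 : (a n : ℕ) = 1 ∨ 2 ≤ (a n : ℕ) := by have := (a n).pos; omega
          · rw [h5, one_mul]
          · have := Nat.mul_le_mul_right (cont a n) h5
            omega
        · exact ⟨0, ht⟩
        · rw [val_two] at ht
          change _ = ((cont a (n + 1) + cont a n : ℕ) : ℤ) at ht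
          omega
      · exact hdigit n hn h0
  choose! r hr using hall
  obtain ⟨s, hs⟩ := exists_state_eq_of_step (y := parityWord a) (N := N) (r := r) fun n hn => by
    -- The observed form at `n + 1` and the one predicted by the automaton both exceed the form at
    -- `n` by even multiples of `q_n`.
    refine eq_of_val_sub_eq (n := n) (z := ρ.digit n - stateDigit a n (r n))
      (by have := (hN n hn).2; omega) ?_
    have h1 := hr n hn
    have h2 := hr (n + 1) (by omega)
    have e2 := ρ.comp_succ n
    have h3 := val_step (a := a) n (r n)
    zify at e2 h3
    linear_combination h1 - h2 + 2 * e2 - h3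
  exact ⟨d + 2, s, eventually_atTop.2 ⟨N, fun n hn => by rw [hr n hn, hs n hn]⟩⟩

end AlphaNumber

/-! ### The `α`-number attached to a `B`-factorisation -/

namespace BFactorisation

/-- The partial sums of the `α`-number attached to a factorisation. -/
def partialSum (F : BFactorisation (parityWord a)) (s : Fin 3) (n : ℕ) : ℕ :=
  ∑ i ∈ Finset.Ico F.start n, stateDigit a i (state (parityWord a) s i) * cont a i

variable {F : BFactorisation (parityWord a)} {s : Fin 3}

theorem partialSum_succ {n : ℕ} (hn : F.start ≤ n) : F.partialSum s (n + 1) =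
    F.partialSum s n + stateDigit a n (state (parityWord a) s n) * cont a n :=
  Finset.sum_Ico_succ_top hn _

theorem two_mul_partialSum (hF : state (parityWord a) s F.start = 1) {n : ℕ} (hn : F.start ≤ n) :
    2 * F.partialSum s n + contShift a F.start = val a n (state (parityWord a) s n) := by
  induction n, hn using Nat.le_induction with
  | base => simp [partialSum, hF, val_one]
  | succ n hn ih =>
    rw [partialSum_succ hn, state, val_step, ← ih]
    ring

theorem two_mul_partialSum_cut (hF : state (parityWord a) s F.start = 1) (j : ℕ) :
    2 * F.partialSum s (F.cut j) + contShift a F.start = contShift a (F.cut j) := by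
  rw [two_mul_partialSum hF (F.cut_strictMono.monotone j.zero_le), state_cut hF, val_one]

theorem partialSum_mono (F : BFactorisation (parityWord a)) (s : Fin 3) :
    Monotone (F.partialSum s) := fun _ _ h =>
  Finset.sum_le_sum_of_subset (Finset.Ico_subset_Ico_right h)

theorem exists_represents (hF : state (parityWord a) s F.start = 1) :
    ∃ ρ : AlphaNumber a, F.Represents ρ ∧ ρ.HasState (contShift a F.start) s := by
  have hlt : ∀ n, F.start ≤ n → 2 ≤ n → F.partialSum s n < cont a n := fun n hn hn2 => by
    have h1 := two_mul_partialSum hF hn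
    have h2 := val_le (a := a) n (state (parityWord a) s n)
    obtain ⟨m, rfl⟩ := Nat.exists_eq_add_of_le' hn2
    have h3 := cont_add_le (a := a) m
    have h4 := cont_pos a m
    change _ ≤ _ + cont a (m + 1) at h2
    omega
  -- The bound `2` ensures `q_{n-1} < q_n`, which may fail at `n = 1`.
  obtain ⟨ρ, hρ⟩ := AlphaNumber.exists_comp_eq (a := a) (N := max F.start 2) (R := F.partialSum s)
    (fun n hn => hlt n (by omega) (by omega))
    (fun n hn => by
      rw [partialSum_succ (by omega), Nat.add_mul_mod_self_right,
        Nat.mod_eq_of_lt (hlt n (by omega) (by omega))])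
  have hmono : ∀ l, F.partialSum s (F.cut l) ≤ F.partialSum s (F.cut (l + 1)) := fun l =>
    F.partialSum_mono s (F.cut_strictMono.monotone l.le_succ)
  refine ⟨ρ, ⟨fun l => F.partialSum s (F.cut (l + 1)) - F.partialSum s (F.cut l), fun l => ?_,
    fun j hj => ?_⟩, eventually_atTop.2 ⟨max F.start 2, fun n hn => ?_⟩⟩
  · have h1 := two_mul_partialSum_cut hF l
    have h2 := two_mul_partialSum_cut hF (l + 1)
    have := hmono l
    dsimp only
    omega
  · have hsum : ∑ l ∈ Finset.range j, (F.partialSum s (F.cut (l + 1)) - F.partialSum s (F.cut l)) =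
        F.partialSum s (F.cut j) := by
      refine (Finset.sum_range_tsub
        ((F.partialSum_mono s).comp F.cut_strictMono.monotone) j).trans ?_
      simp [partialSum, cut, cutAt]
    rw [hsum]
    have h1 := two_mul_partialSum_cut hF j
    have h2 : F.start ≤ F.cut j := F.cut_strictMono.monotone j.zero_le
    obtain ⟨C, hC⟩ := Nat.exists_eq_add_of_le' hj
    rw [hC] at h1 h2 ⊢
    rw [Nat.add_sub_cancel]
    -- The sum up to the cut `C + 1` is already below `q_C`, so it is also the component at `c_j =
    -- C`, one index earlier.
    have h3 : F.partialSum s (C + 1) < cont a C := by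
      have := cont_pos a C
      change _ = cont a C at h1
      omega
    rcases C with _ | C
    · have h4 := ρ.lt 0
      have h5 : cont a 0 = 1 := rfl
      omega
    · rw [← ρ.compat, hρ (C + 1 + 1) (by omega), Nat.mod_eq_of_lt h3]
  · rw [hρ n hn]
    exact_mod_cast two_mul_partialSum hF (n := n) (by omega)

/-- The half-differences are forced, and agreement at the unbounded indices `c_j` determines all
components. -/
theorem Represents.unique {ρ γ : AlphaNumber a} (hρ : F.Represents ρ) (hγ : F.Represents γ) :
    ρ = γ := by
  obtain ⟨h, h1, h2⟩ := hρ
  obtain ⟨h', h1', h2'⟩ := hγ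
  obtain rfl : h = h' := funext fun l => by have := h1 l; have := h1' l; omega
  refine AlphaNumber.eq_of_frequently (frequently_atTop.2 fun n => ?_)
  have hn : n + 1 ≤ F.cut (n + 1) := F.cut_strictMono.id_le (n + 1)
  exact ⟨F.cut (n + 1) - 1, by omega, by rw [h2 _ (by omega), h2' _ (by omega)]⟩

theorem Represents.hasState {ρ : AlphaNumber a} (hρ : F.Represents ρ)
    (hF : state (parityWord a) s F.start = 1) : ρ.HasState (contShift a F.start) s := by
  obtain ⟨γ, hγ, h⟩ := exists_represents hF
  rwa [hρ.unique hγ]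

end BFactorisation

end Sturm

theorem mainTheorem7 (α : ℝ) (a : ℕ → ℕ+) (hα : Sturm.IsSlope α a)
    (hodd : ¬ ∀ᶠ i in atTop, Even (a i : ℕ)) :
    -- the construction: every `B`-factorisation of an indexed suffix of the parity word
    -- defines an `α`-number, of non-zero class, equivalent to its complement
    (∀ F : Sturm.BFactorisation (Sturm.parityWord a), ∃! ρ : Sturm.AlphaNumber a,
      F.Represents ρ) ∧
    (∀ (F : Sturm.BFactorisation (Sturm.parityWord a)) (ρ : Sturm.AlphaNumber a),
      F.Represents ρ → ¬ ρ.Equivalent 0 ∧ ρ.EquivalentToComplement) ∧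
    -- two of these `α`-numbers are equivalent iff the factorisations are
    (∀ (F G : Sturm.BFactorisation (Sturm.parityWord a)) (ρ γ : Sturm.AlphaNumber a),
      F.Represents ρ → G.Represents γ → (ρ.Equivalent γ ↔ F.Equivalent G)) ∧
    -- there are exactly three classes of factorisations, and the three corresponding classes of
    -- `α`-numbers are exactly the non-zero classes of `α`-numbers equivalent to their complement
    ∃ (F : Fin 3 → Sturm.BFactorisation (Sturm.parityWord a)) (ρ : Fin 3 → Sturm.AlphaNumber a),
      (∀ i, (F i).Represents (ρ i)) ∧
      (Pairwise fun i j => ¬ (F i).Equivalent (F j)) ∧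
      (∀ G : Sturm.BFactorisation (Sturm.parityWord a), ∃ i, G.Equivalent (F i)) ∧
      (∀ i, ¬ (ρ i).Equivalent 0 ∧ (ρ i).EquivalentToComplement) ∧
      (Pairwise fun i j => ¬ (ρ i).Equivalent (ρ j)) ∧
      (∀ γ : Sturm.AlphaNumber a, ¬ γ.Equivalent 0 → γ.EquivalentToComplement →
        ∃ i, γ.Equivalent (ρ i)) := by
  open Sturm BFactorisation AlphaNumber in
  have hy : ∃ᶠ n in atTop, parityWord a n = 1 := fun h => hodd (h.mono fun n hn => by
    by_contra hne
    exact hn (parityWord_of_odd hne))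
  have hlabel := fun G : BFactorisation (parityWord a) => exists_state_eq (parityWord a) G.start 1
  have h2 : ∀ (F : BFactorisation (parityWord a)) (ρ : AlphaNumber a),
      F.Represents ρ → ¬ ρ.Equivalent 0 ∧ ρ.EquivalentToComplement := fun F ρ hρ => by
    obtain ⟨s, hs⟩ := hlabel F
    have h := hρ.hasState hs
    exact ⟨h.isNonzeroClass.not_equivalent_zero, h.equivalentToComplement⟩
  have h3 : ∀ (F G : BFactorisation (parityWord a)) (ρ γ : AlphaNumber a),
      F.Represents ρ → G.Represents γ → (ρ.Equivalent γ ↔ F.Equivalent G) := fun F G ρ γ hρ hγ => by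
    obtain ⟨s, hs⟩ := hlabel F
    obtain ⟨t, ht⟩ := hlabel G
    have h := hρ.hasState hs
    have h' := hγ.hasState ht
    rw [equivalent_iff hs ht]
    exact ⟨h.state_eq h', fun e => by subst e; exact h.equivalent h'⟩
  -- The three classes are indexed by the initial state whose sequence is in state `1` at the start
  -- of the factorisation.
  choose F hF using exists_of_state hy
  choose ρ hρ hst using fun s => exists_represents (hF s)
  have hne : Pairwise fun i j => ¬ (F i).Equivalent (F j) := fun i j hij h =>
    hij ((equivalent_iff (hF i) (hF j)).1 h)
  refine ⟨fun G => ?_, h2, h3, F, ρ, hρ, hne, fun G => ?_, fun i => h2 _ _ (hρ i),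
    fun i j hij h => hne hij ((h3 _ _ _ _ (hρ i) (hρ j)).1 h), fun γ h0 hc => ?_⟩
  · obtain ⟨s, hs⟩ := hlabel G
    obtain ⟨γ, hγ, -⟩ := exists_represents hs
    exact ⟨γ, hγ, fun γ' hγ' => hγ'.unique hγ⟩
  · obtain ⟨s, hs⟩ := hlabel G
    exact ⟨s, (equivalent_iff hs (hF s)).2 rfl⟩
  · obtain ⟨e, s, h⟩ := exists_hasState (isNonzeroClass_of_not_equivalent_zero h0) hc
    exact ⟨s, h.equivalent (hst s)⟩
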